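/- A family $\mathcal F$ of sets has the \emph{$(p+1,2)$ property} if among any $p+1$ distinct members of $\mathcal F$ some two have a nonempty intersection. The \emph{matching number} of $\mathcal F$ is the largest size of a subfamily of pairwise disjoint sets. A family of sets in $\mathbb R^2$ is \emph{pierced by $k$ lines} if there exist $k$ lines in $\mathbb R^2$ whose union intersects every set of the family. Let $p\ge 1$ be an integer. (1) A family $\mathcal F$ of sets in $\mathbb R^2$ has the $(p+1,2)$ property if and only if its matching number is at most $p$. (2) If $\mathcal F$ is a finite family of nonempty compact convex sets in $\mathbb R^2$ with the $(p+1,2)$ property, then $\mathcal F$ is pierced by $\lfloor p/2\rfloor+1$ lines. (3) The bound in (2) is tight: for every regular $(2p+1)$-gon in $\mathbb R^2$, the family of its edges (closed segments; a finite family of nonempty compact convex sets) has the $(p+1,2)$ property, and the smallest $k$ such that this family is pierced by $k$ lines is exactly $\lfloor p/2\rfloor+1$. -/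

import Mathlib

/-- A family `F` of sets has the `(p, q)` property if among any `p` (distinct) members of `F`
some `q` have a point in common. -/
def HasPQProperty {X : Type*} (F : Set (Set X)) (p q : ℕ) : Prop :=
  ∀ S : Finset (Set X), (S : Set (Set X)) ⊆ F → S.card = p →
    ∃ T : Finset (Set X), T ⊆ S ∧ T.card = q ∧ (⋂ A ∈ T, A).Nonempty

/-- The matching number of `F`: the largest size of a subfamily of pairwise disjoint sets
(with value `⊤` if there are arbitrarily large such subfamilies). -/
noncomputable def matchingNumber {X : Type*} (F : Set (Set X)) : ℕ∞ :=
  ⨆ (S : Finset (Set X)) (_ : (S : Set (Set X)) ⊆ F ∧ (S : Set (Set X)).PairwiseDisjoint id),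
    (S.card : ℕ∞)

/-- `F` is pierced by `k` lines: there are `k` (distinct) lines whose union meets every member
of `F`. -/
def PiercedByLines {d : ℕ} (F : Set (Set (EuclideanSpace ℝ (Fin d)))) (k : ℕ) : Prop :=
  ∃ L : Finset (AffineSubspace ℝ (EuclideanSpace ℝ (Fin d))),
    L.card = k ∧ (∀ l ∈ L, Module.finrank ℝ l.direction = 1) ∧
      ∀ A ∈ F, (A ∩ ⋃ l ∈ L, (l : Set (EuclideanSpace ℝ (Fin d)))).Nonempty

/-- The `j`-th vertex of the regular `n`-gon with centre `c`, circumradius `r` and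
`0`-th vertex in direction `θ`. -/
noncomputable def regularPolygonVertex (n : ℕ) (c : EuclideanSpace ℝ (Fin 2)) (r θ : ℝ) (j : ℕ) :
    EuclideanSpace ℝ (Fin 2) :=
  c + r • !₂[Real.cos (θ + 2 * Real.pi * j / n), Real.sin (θ + 2 * Real.pi * j / n)]

/-- The family of the edges of that regular `n`-gon; the edge with index `n - 1` joins the last
vertex to the `n`-th one, which is the `0`-th one. -/
noncomputable def regularPolygonEdges (n : ℕ) (c : EuclideanSpace ℝ (Fin 2)) (r θ : ℝ) :
    Set (Set (EuclideanSpace ℝ (Fin 2))) :=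
  {e | ∃ j < n, e = segment ℝ (regularPolygonVertex n c r θ j)
    (regularPolygonVertex n c r θ (j + 1))}

/-!
The equivalence between the `(p + 1, 2)` property and the bound on the matching number is a matter
of unfolding: a set of `p + 1` members without an intersecting pair is a pairwise disjoint one.

The upper bound rests on the KKM theorem. Put `k = p / 2 + 1` and suppose that no `k` lines pierce
the family, which lies in an open disc. A point `x` of the simplex with `2k` vertices cuts the
boundary circle into `2k` consecutive arcs of lengths proportional to the coordinates of `x`, and
the `k` lines through opposite division points are oriented so that reversing a line shifts its
index by `k`. Some member misses all these lines, and the signs of the `2k` oriented lines on it are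
constant and cyclically antisymmetric, so there is an index `i` with sign `+` at `i` and sign `-` at
`i + 1`; the first such `i` is the label of the member (`exists_forall_inCell`). If the `i`-th arc
is degenerate, then no point of the disc has these two signs (`diagFun_succ_nonneg`), so the open
sets "some member has label `i`" satisfy the hypotheses of the KKM theorem. At a common point there
are `2k ≥ p + 1` members with different labels. They are pairwise disjoint, because the label can be
read off from any point of a member.

The KKM theorem (`exists_mem_forall_mem_of_cover`) is deduced from the fact that a `C¹` map `F` of a
simplex that preserves every face cannot send the simplex into its boundary
(`exists_image_mem_openCornerSimplex`). The proof is the volume argument of Milnor and Rogers: for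
small `t` the map `x ↦ x + t (F x - x)` is a bijection of the open simplex, so the integral of its
Jacobian is the volume of the simplex. This integral is a polynomial in `t`, so it is the volume for
`t = 1` too, whereas the Jacobian of `F` vanishes if `F` takes values in the boundary.

For tightness, two of any `p + 1` indices modulo `2p + 1` are consecutive, which gives two edges
with a common vertex. A line that meets an edge meets the circumcircle in the closed arc over that
edge. There are at most two such points, each in at most two closed arcs, so a line meets at most
four edges (`exists_edge_indices_of_line`). Hence `4k ≥ 2p + 1` for any `k` piercing lines, that is,
`k ≥ p / 2 + 1`.
-/

open Set Filter Topology MeasureTheory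

/-! ### The simplex in coordinates -/

/-- Barycentric coordinates with respect to the simplex in `ℝᵐ` spanned by the origin and the
standard basis vectors; the coordinate with index `0` belongs to the origin. -/
def baryCoord {m : ℕ} (x : Fin m → ℝ) : Fin (m + 1) → ℝ :=
  Fin.cons (1 - ∑ i, x i) x

/-- The closed simplex in `ℝᵐ` spanned by the origin and the standard basis vectors. -/
def cornerSimplex (m : ℕ) : Set (Fin m → ℝ) := {x | ∀ i, 0 ≤ baryCoord x i}

/-- The corresponding open simplex. -/
def openCornerSimplex (m : ℕ) : Set (Fin m → ℝ) := {x | ∀ i, 0 < baryCoord x i}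

section Simplex

variable {m : ℕ}

lemma sum_baryCoord (x : Fin m → ℝ) : ∑ i, baryCoord x i = 1 := by
  simp [baryCoord, Fin.sum_univ_succ]

lemma baryCoord_tail {y : Fin (m + 1) → ℝ} (hy : ∑ i, y i = 1) :
    baryCoord (Fin.tail y) = y := by
  rw [Fin.sum_univ_succ] at hy
  have h0 : 1 - ∑ i, Fin.tail y i = y 0 := by
    simp only [Fin.tail]
    linarith
  rw [baryCoord, h0, Fin.cons_self_tail]

lemma baryCoord_combo (x y : Fin m → ℝ) (t : ℝ) (i : Fin (m + 1)) :
    baryCoord (x + t • (y - x)) i = (1 - t) * baryCoord x i + t * baryCoord y i := by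
  refine Fin.cases ?_ (fun j => ?_) i
  · simp only [baryCoord, Fin.cons_zero, Pi.add_apply, Pi.smul_apply, Pi.sub_apply, smul_eq_mul,
      Finset.sum_add_distrib, ← Finset.mul_sum, Finset.sum_sub_distrib]
    ring
  · simp only [baryCoord, Fin.cons_succ, Pi.add_apply, Pi.smul_apply, Pi.sub_apply, smul_eq_mul]
    ring

lemma continuous_baryCoord (i : Fin (m + 1)) : Continuous fun x : Fin m → ℝ => baryCoord x i := by
  refine Fin.cases ?_ (fun j => ?_) i
  · simp only [baryCoord, Fin.cons_zero]
    fun_prop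
  · simp only [baryCoord, Fin.cons_succ]
    fun_prop

lemma openCornerSimplex_subset : openCornerSimplex m ⊆ cornerSimplex m :=
  fun _ hx i => (hx i).le

lemma isOpen_openCornerSimplex : IsOpen (openCornerSimplex m) := by
  simp only [openCornerSimplex, ofPred_forall]
  exact isOpen_iInter_of_finite fun i => isOpen_lt continuous_const (continuous_baryCoord i)

lemma isClosed_cornerSimplex : IsClosed (cornerSimplex m) := by
  simp only [cornerSimplex, ofPred_forall]
  exact isClosed_iInter fun i => isClosed_le continuous_const (continuous_baryCoord i)

lemma baryCoord_le_one {x : Fin m → ℝ} (hx : x ∈ cornerSimplex m) (i : Fin (m + 1)) :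
    baryCoord x i ≤ 1 := by
  rw [← sum_baryCoord x]
  exact Finset.single_le_sum (fun j _ => hx j) (Finset.mem_univ i)

lemma isCompact_cornerSimplex : IsCompact (cornerSimplex m) := by
  refine (isCompact_Icc (a := (0 : Fin m → ℝ)) (b := 1)).of_isClosed_subset
    isClosed_cornerSimplex fun x hx => ⟨fun i => ?_, fun i => ?_⟩
  · simpa [baryCoord] using hx i.succ
  · simpa [baryCoord] using baryCoord_le_one hx i.succ

lemma convex_cornerSimplex : Convex ℝ (cornerSimplex m) := by
  refine (convex_iff_add_mem).2 fun x hx y hy a b ha hb hab i => ?_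
  have h : a • x + b • y = x + b • (y - x) := by
    rw [← eq_sub_iff_add_eq] at hab
    subst hab
    module
  rw [h, baryCoord_combo]
  have := hx i
  have := hy i
  have : 0 ≤ 1 - b := by linarith
  positivity

lemma convex_openCornerSimplex : Convex ℝ (openCornerSimplex m) := by
  refine (convex_iff_add_mem).2 fun x hx y hy a b ha hb hab i => ?_
  have h : a • x + b • y = x + b • (y - x) := by
    rw [← eq_sub_iff_add_eq] at hab
    subst hab
    module
  rw [h, baryCoord_combo, ← hab, add_sub_cancel_right]
  rcases ha.eq_or_lt with rfl | ha
  · have hb1 : b = 1 := by linarith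
    simpa [hb1] using hy i
  · exact add_pos_of_pos_of_nonneg (mul_pos ha (hx i)) (mul_nonneg hb (hy i).le)

lemma openCornerSimplex_nonempty : (openCornerSimplex m).Nonempty := by
  refine ⟨Fin.tail fun _ : Fin (m + 1) => ((m : ℝ) + 1)⁻¹, fun i => ?_⟩
  rw [baryCoord_tail]
  · positivity
  · simp only [Finset.sum_const, Finset.card_univ, Fintype.card_fin, nsmul_eq_mul]
    push_cast
    field_simp

end Simplex

/-! ### Maps of the simplex that preserve its faces -/

section Degree

variable {m : ℕ}

/-- As `det (1 + t M)` is a polynomial in `t` of degree at most `m`, its value at `1` is a fixed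
linear combination of its values at any `m + 1` nodes. -/
lemma det_id_add_eq_interpolate (s : Finset ℝ) (hs : s.card = m + 1)
    (M : (Fin m → ℝ) →L[ℝ] (Fin m → ℝ)) :
    (ContinuousLinearMap.id ℝ _ + M).det =
      ∑ t ∈ s, (ContinuousLinearMap.id ℝ _ + t • M).det * (Lagrange.basis s id t).eval 1 := by
  classical
  set A := LinearMap.toMatrix' (M : (Fin m → ℝ) →ₗ[ℝ] (Fin m → ℝ)) with hA
  set q : Polynomial ℝ := Matrix.det
    ((Polynomial.X : Polynomial ℝ) • A.map Polynomial.C + (1 : Matrix _ _ ℝ).map Polynomial.C)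
    with hq
  have hqe : ∀ t : ℝ, q.eval t = (ContinuousLinearMap.id ℝ _ + t • M).det := by
    intro t
    rw [hq, ← Polynomial.coe_evalRingHom, RingHom.map_det, ContinuousLinearMap.det,
      ← LinearMap.det_toMatrix']
    have hM : LinearMap.toMatrix' ((ContinuousLinearMap.id ℝ (Fin m → ℝ) + t • M :
        (Fin m → ℝ) →L[ℝ] (Fin m → ℝ)) : (Fin m → ℝ) →ₗ[ℝ] (Fin m → ℝ)) = 1 + t • A := by
      rw [ContinuousLinearMap.toLinearMap_add, ContinuousLinearMap.toLinearMap_smul,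
        map_add LinearMap.toMatrix', map_smul LinearMap.toMatrix', ← hA,
        ContinuousLinearMap.coe_id, LinearMap.toMatrix'_id]
    rw [hM]
    congr 1
    ext i j
    simp [Matrix.one_apply, add_comm, apply_ite]
    exact mul_comm _ _
  have hdeg : q.degree < s.card := by
    refine lt_of_le_of_lt Polynomial.degree_le_natDegree ?_
    have := Polynomial.natDegree_det_X_add_C_le A 1
    rw [Fintype.card_fin] at this
    rw [hs]
    exact_mod_cast Nat.lt_succ_of_le this
  have h1 := hqe 1
  rw [one_smul] at h1
  rw [← h1, Lagrange.eq_interpolate (v := id) (Function.injective_id.injOn) hdeg,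
    Lagrange.interpolate_apply, Polynomial.eval_finsetSum]
  refine Finset.sum_congr rfl fun t _ => ?_
  rw [← hqe t]
  simp

variable {F : (Fin m → ℝ) → Fin m → ℝ}

lemma hasStrictFDerivAt_homotopy (hF : ContDiff ℝ 1 F) (t : ℝ) (x : Fin m → ℝ) :
    HasStrictFDerivAt (fun x => x + t • (F x - x))
      (ContinuousLinearMap.id ℝ _ + t • (fderiv ℝ F x - ContinuousLinearMap.id ℝ _)) x :=
  (hasStrictFDerivAt_id x).add
    (((hF.contDiffAt.hasStrictFDerivAt (by simp)).sub (hasStrictFDerivAt_id x)).const_smul t)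

lemma map_nhds_eq_of_det_ne_zero {f : (Fin m → ℝ) → Fin m → ℝ}
    {f' : (Fin m → ℝ) →L[ℝ] (Fin m → ℝ)} {x : Fin m → ℝ} (hf : HasStrictFDerivAt f f' x)
    (hdet : f'.det ≠ 0) : map f (𝓝 x) = 𝓝 (f x) :=
  hf.map_nhds_eq_of_surj (LinearMap.range_eq_top.2 (LinearMap.equivOfDetNeZero
    (f' : (Fin m → ℝ) →ₗ[ℝ] (Fin m → ℝ)) hdet).surjective)

/-- For small `t`, the homotopy has positive Jacobian on the simplex. -/
lemma eventually_det_homotopy_pos (hF : ContDiff ℝ 1 F) :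
    ∀ᶠ t : ℝ in 𝓝 0, ∀ x ∈ cornerSimplex m,
      0 < (ContinuousLinearMap.id ℝ _ +
        t • (fderiv ℝ F x - ContinuousLinearMap.id ℝ _)).det := by
  refine isCompact_cornerSimplex.eventually_forall_of_forall_eventually fun x _ => ?_
  have hc : Continuous fun z : ℝ × (Fin m → ℝ) => (ContinuousLinearMap.id ℝ (Fin m → ℝ) +
      z.1 • (fderiv ℝ F z.2 - ContinuousLinearMap.id ℝ _)).det := by
    have h1 : Continuous (fderiv ℝ F) := hF.continuous_fderiv (by simp)
    refine ContinuousLinearMap.continuous_det.comp ?_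
    fun_prop
  refine hc.continuousAt.eventually (lt_mem_nhds ?_)
  simp [ContinuousLinearMap.det]

/-- For small `t`, the homotopy is injective on the simplex. -/
lemma eventually_injOn_homotopy (hF : ContDiff ℝ 1 F) :
    ∀ᶠ t : ℝ in 𝓝 0, InjOn (fun x => x + t • (F x - x)) (cornerSimplex m) := by
  obtain ⟨C, hC⟩ := (isCompact_cornerSimplex (m := m)).exists_bound_of_continuousOn
    (f := fderiv ℝ fun x => F x - x) ((hF.sub contDiff_id).continuous_fderiv (by simp)).continuousOn
  have hlip : LipschitzOnWith C.toNNReal (fun x => F x - x) (cornerSimplex m) :=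
    convex_cornerSimplex.lipschitzOnWith_of_nnnorm_fderiv_le
      (fun x _ => (hF.sub contDiff_id).differentiable (by simp) x)
      fun x hx => by
        rw [← NNReal.coe_le_coe]
        exact (hC x hx).trans (Real.le_coe_toNNReal C)
  have hsmall : ∀ᶠ t : ℝ in 𝓝 0, |t| * C.toNNReal < 1 := by
    have : Continuous fun t : ℝ => |t| * (C.toNNReal : ℝ) := by fun_prop
    exact this.continuousAt.eventually (gt_mem_nhds (by simp))
  filter_upwards [hsmall] with t ht x hx y hy hxy
  have h1 := hlip.dist_le_mul x hx y hy
  have h2 : x - y = t • ((F y - y) - (F x - x)) := by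
    have : x + t • (F x - x) = y + t • (F y - y) := hxy
    rw [← sub_eq_zero] at this ⊢
    rw [← this]
    module
  by_contra hne
  have hpos : 0 < dist x y := dist_pos.2 hne
  have h3 : dist x y ≤ |t| * (C.toNNReal * dist x y) := by
    rw [dist_eq_norm x y]
    nth_rewrite 1 [h2]
    rw [norm_smul, Real.norm_eq_abs, ← dist_eq_norm x y, ← dist_eq_norm, dist_comm]
    exact mul_le_mul_of_nonneg_left h1 (abs_nonneg t)
  nlinarith

/-- While the homotopy of a face-preserving map has nonzero Jacobian, it maps the open simplex
onto itself: the image is open in the open simplex and, as boundary points stay on the boundary,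
also closed. -/
lemma image_homotopy_openCornerSimplex (hF : ContDiff ℝ 1 F)
    (hmaps : MapsTo F (cornerSimplex m) (cornerSimplex m))
    (hface : ∀ x ∈ cornerSimplex m, ∀ i, baryCoord x i = 0 → baryCoord (F x) i = 0)
    {t : ℝ} (ht0 : 0 < t) (ht1 : t < 1)
    (hdet : ∀ x ∈ cornerSimplex m, 0 < (ContinuousLinearMap.id ℝ _ +
        t • (fderiv ℝ F x - ContinuousLinearMap.id ℝ _)).det) :
    (fun x => x + t • (F x - x)) '' openCornerSimplex m = openCornerSimplex m := by
  set f := fun x => x + t • (F x - x) with hf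
  have hfc : Continuous f := by
    have := hF.continuous
    fun_prop
  have hsub : f '' openCornerSimplex m ⊆ openCornerSimplex m := by
    rintro _ ⟨x, hx, rfl⟩ i
    rw [hf, baryCoord_combo]
    exact add_pos_of_pos_of_nonneg (mul_pos (by linarith) (hx i))
      (mul_nonneg ht0.le (hmaps (openCornerSimplex_subset hx) i))
  have hopen : IsOpen (f '' openCornerSimplex m) := by
    rw [isOpen_iff_mem_nhds]
    rintro _ ⟨x, hx, rfl⟩
    rw [← map_nhds_eq_of_det_ne_zero (hasStrictFDerivAt_homotopy hF t x)
      (hdet x (openCornerSimplex_subset hx)).ne']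
    exact image_mem_map (isOpen_openCornerSimplex.mem_nhds hx)
  have hclosed : closure (f '' openCornerSimplex m) ⊆ f '' cornerSimplex m :=
    closure_minimal (image_mono openCornerSimplex_subset)
      (isCompact_cornerSimplex.image hfc).isClosed
  refine hsub.antisymm ?_
  refine convex_openCornerSimplex.isPreconnected.subset_of_closure_inter_subset hopen ?_ ?_
  · obtain ⟨x, hx⟩ := openCornerSimplex_nonempty (m := m)
    exact ⟨f x, hsub ⟨x, hx, rfl⟩, x, hx, rfl⟩
  · rintro y ⟨hy, hyo⟩
    obtain ⟨x, hx, rfl⟩ := hclosed hy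
    refine ⟨x, fun i => (hx i).lt_of_ne' fun h0 => ?_, rfl⟩
    have := hyo i
    rw [hf, baryCoord_combo, h0, hface x hx i h0] at this
    simp at this

/-- A `C¹` map of the simplex that maps every face to itself cannot map the simplex into its
boundary. The volume of the image of the open simplex under `x ↦ x + t (F x - x)` is constant for
small `t` and is given by a polynomial in `t`; this polynomial would vanish at `t = 1`. -/
theorem exists_image_mem_openCornerSimplex (hF : ContDiff ℝ 1 F)
    (hmaps : MapsTo F (cornerSimplex m) (cornerSimplex m))
    (hface : ∀ x ∈ cornerSimplex m, ∀ i, baryCoord x i = 0 → baryCoord (F x) i = 0) :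
    ∃ x ∈ cornerSimplex m, F x ∈ openCornerSimplex m := by
  by_contra! hcon
  set I := ContinuousLinearMap.id ℝ (Fin m → ℝ) with hI
  have hgood : ∀ᶠ t : ℝ in 𝓝[>] 0, ∫ x in openCornerSimplex m,
      (I + t • (fderiv ℝ F x - I)).det = volume.real (openCornerSimplex m) := by
    filter_upwards [nhdsWithin_le_nhds (eventually_det_homotopy_pos hF),
      nhdsWithin_le_nhds (eventually_injOn_homotopy hF), self_mem_nhdsWithin,
      nhdsWithin_le_nhds (gt_mem_nhds zero_lt_one)] with t hdet hinj ht0 ht1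
    have hch := integral_image_eq_integral_abs_det_fderiv_smul (μ := volume)
      (isOpen_openCornerSimplex (m := m)).measurableSet
      (fun x _ => (hasStrictFDerivAt_homotopy hF t x).hasFDerivAt.hasFDerivWithinAt)
      (hinj.mono openCornerSimplex_subset) fun _ => (1 : ℝ)
    rw [image_homotopy_openCornerSimplex hF hmaps hface ht0 ht1 hdet] at hch
    simp only [integral_const, smul_eq_mul, mul_one, measureReal_restrict_apply_univ] at hch
    rw [hch]
    refine setIntegral_congr_fun isOpen_openCornerSimplex.measurableSet fun x hx => ?_
    exact (abs_of_pos (hdet x (openCornerSimplex_subset hx))).symm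
  have hinf : {t : ℝ | ∫ x in openCornerSimplex m,
      (I + t • (fderiv ℝ F x - I)).det = volume.real (openCornerSimplex m)}.Infinite := by
    obtain ⟨ε, hε, hsub⟩ := mem_nhdsGT_iff_exists_Ioo_subset.1 hgood
    exact (Ioo_infinite hε).mono hsub
  obtain ⟨s, hsub, hs⟩ := hinf.exists_subset_card_eq (m + 1)
  have hvol : 0 < volume.real (openCornerSimplex m) := by
    refine ENNReal.toReal_pos
      (isOpen_openCornerSimplex.measure_pos _ openCornerSimplex_nonempty).ne' ?_
    exact ((measure_mono openCornerSimplex_subset).trans_lt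
      isCompact_cornerSimplex.measure_lt_top).ne
  have hint : ∀ t : ℝ, IntegrableOn (fun x => (I + t • (fderiv ℝ F x - I)).det)
      (openCornerSimplex m) := by
    intro t
    have h1 : Continuous (fderiv ℝ F) := hF.continuous_fderiv (by simp)
    have hc : Continuous fun x => (I + t • (fderiv ℝ F x - I)).det :=
      ContinuousLinearMap.continuous_det.comp (by fun_prop)
    exact (hc.continuousOn.integrableOn_compact isCompact_cornerSimplex).mono_set
      openCornerSimplex_subset
  -- Where the Jacobian of `F` is nonzero, `F` is an open map, so some values near a boundary point
  -- would lie in the open simplex.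
  have hzero : ∀ x ∈ openCornerSimplex m, (I + (fderiv ℝ F x - I)).det = 0 := by
    intro x hx
    rw [add_sub_cancel]
    by_contra hne
    have hmap := map_nhds_eq_of_det_ne_zero (hF.contDiffAt.hasStrictFDerivAt (by simp)) hne
    have hmem : F '' cornerSimplex m ∈ 𝓝 (F x) := by
      rw [← hmap]
      exact image_mem_map (mem_of_superset (isOpen_openCornerSimplex.mem_nhds hx)
        openCornerSimplex_subset)
    obtain ⟨c, hc⟩ := openCornerSimplex_nonempty (m := m)
    have htend : Tendsto (fun s : ℝ => F x + s • (c - F x)) (𝓝[>] 0) (𝓝 (F x)) := by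
      have : Continuous fun s : ℝ => F x + s • (c - F x) := by fun_prop
      simpa using (this.tendsto 0).mono_left nhdsWithin_le_nhds
    obtain ⟨s, ⟨z, hz, hzs⟩, hs0, hs1⟩ := ((htend.eventually hmem).and
      (Ioo_mem_nhdsGT (zero_lt_one (α := ℝ)))).exists
    refine hcon z hz fun i => ?_
    rw [hzs, baryCoord_combo]
    exact add_pos_of_nonneg_of_pos
      (mul_nonneg (by linarith) (hmaps (openCornerSimplex_subset hx) i)) (mul_pos hs0 (hc i))
  have hsum : ∫ x in openCornerSimplex m, (I + (fderiv ℝ F x - I)).det =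
      volume.real (openCornerSimplex m) := by
    rw [integral_congr_ae (Eventually.of_forall fun x => det_id_add_eq_interpolate s hs _),
      integral_finsetSum _ fun t _ => (hint t).mul_const _]
    simp_rw [integral_mul_const]
    rw [Finset.sum_congr rfl fun t ht => by rw [show _ = _ from hsub ht], ← Finset.mul_sum,
      ← Polynomial.eval_finsetSum, Lagrange.sum_basis Function.injective_id.injOn
        (Finset.card_pos.1 (by omega))]
    simp
  rw [setIntegral_congr_fun isOpen_openCornerSimplex.measurableSet hzero] at hsum
  simp at hsum
  exact hvol.ne hsum

/-- The theorem of Knaster, Kuratowski and Mazurkiewicz for open sets: if the sets `U i` cover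
the simplex and `U i` avoids the facet on which the `i`-th barycentric coordinate vanishes, then
the sets have a common point in the simplex. -/
theorem exists_mem_forall_mem_of_cover (U : Fin (m + 1) → Set (Fin m → ℝ))
    (hU : ∀ i, IsOpen (U i)) (hcover : cornerSimplex m ⊆ ⋃ i, U i)
    (hface : ∀ x ∈ cornerSimplex m, ∀ i, x ∈ U i → baryCoord x i ≠ 0) :
    ∃ x ∈ cornerSimplex m, ∀ i, x ∈ U i := by
  choose φ hsupp hφ hrange using fun i => (hU i).exists_contDiff_support_eq (n := 1)
  obtain ⟨ψ, hψsupp, hψ, hψrange⟩ :=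
    (isClosed_cornerSimplex (m := m)).isOpen_compl.exists_contDiff_support_eq (n := 1)
  have hφ0 : ∀ i x, 0 ≤ φ i x := fun i x => (hrange i ⟨x, rfl⟩).1
  have hφmem : ∀ i x, x ∈ U i ↔ φ i x ≠ 0 := fun i x => by
    rw [← hsupp i, Function.mem_support]
  have hψ0 : ∀ x, 0 ≤ ψ x := fun x => (hψrange ⟨x, rfl⟩).1
  -- The denominator is positive everywhere: `ψ` takes care of the points outside the simplex.
  set D : (Fin m → ℝ) → ℝ := fun x => ∑ i, φ i x + ψ x with hD
  have hDpos : ∀ x, 0 < D x := by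
    intro x
    by_cases hx : x ∈ cornerSimplex m
    · obtain ⟨i, hi⟩ := mem_iUnion.1 (hcover hx)
      have h1 : 0 < φ i x := (hφ0 i x).lt_of_ne' ((hφmem i x).1 hi)
      have h2 : φ i x ≤ ∑ i, φ i x :=
        Finset.single_le_sum (f := fun i => φ i x) (fun j _ => hφ0 j x) (Finset.mem_univ i)
      have := hψ0 x
      simp only [hD]
      linarith
    · have h1 : ψ x ≠ 0 := by
        rw [← Function.mem_support, hψsupp]
        exact hx
      have h2 := (hψ0 x).lt_of_ne' h1
      have h3 : 0 ≤ ∑ i, φ i x := Finset.sum_nonneg fun i _ => hφ0 i x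
      simp only [hD]
      linarith
  have hDsimplex : ∀ x ∈ cornerSimplex m, D x = ∑ i, φ i x := by
    intro x hx
    have : ψ x = 0 := by
      by_contra h
      rw [← ne_eq, ← Function.mem_support, hψsupp] at h
      exact h hx
    simp [hD, this]
  have hDc : ContDiff ℝ 1 D :=
    (ContDiff.sum fun i _ => by exact_mod_cast hφ i).add (by exact_mod_cast hψ)
  set F : (Fin m → ℝ) → Fin m → ℝ := fun x => Fin.tail fun i => φ i x / D x with hFdef
  have hF : ContDiff ℝ 1 F := by
    refine contDiff_pi.2 fun i => ?_
    exact ContDiff.div (by exact_mod_cast hφ i.succ) hDc fun x => (hDpos x).ne'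
  have hbary : ∀ x ∈ cornerSimplex m, ∀ i, baryCoord (F x) i = φ i x / D x := by
    intro x hx i
    rw [hFdef, baryCoord_tail]
    rw [← Finset.sum_div, ← hDsimplex x hx, div_self (hDpos x).ne']
  obtain ⟨x, hx, hxo⟩ := exists_image_mem_openCornerSimplex hF
    (fun x hx i => by
      rw [hbary x hx]
      exact div_nonneg (hφ0 i x) (hDpos x).le)
    (fun x hx i hi => by
      rw [hbary x hx]
      by_contra hne
      exact hface x hx i ((hφmem i x).2 fun h0 => hne (by rw [h0, zero_div])) hi)
  refine ⟨x, hx, fun i => (hφmem i x).2 fun h0 => ?_⟩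
  have := hxo i
  rw [hbary x hx, h0, zero_div] at this
  exact lt_irrefl _ this

end Degree

/-! ### Lines through two points of a circle -/

/-- An affine function that vanishes on the line through the points of the circle of radius `r`
about the origin with polar angles `α` and `β`. For `α ≤ β ≤ α + 2π` it is positive beyond the
arc from `α` to `β`. If both points agree, it describes the tangent, so the line is never
degenerate. -/
noncomputable def chordFun (r α β : ℝ) (z : EuclideanSpace ℝ (Fin 2)) : ℝ :=
  z 0 * Real.cos ((α + β) / 2) + z 1 * Real.sin ((α + β) / 2) - r * Real.cos ((β - α) / 2)

lemma chordFun_swap (r α β : ℝ) (z : EuclideanSpace ℝ (Fin 2)) :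
    chordFun r β (α + 2 * Real.pi) z = -chordFun r α β z := by
  have h1 : (β + (α + 2 * Real.pi)) / 2 = (α + β) / 2 + Real.pi := by ring
  have h2 : (α + 2 * Real.pi - β) / 2 = -((β - α) / 2) + Real.pi := by ring
  simp only [chordFun, h1, h2, Real.cos_add_pi, Real.sin_add_pi, Real.cos_neg]
  ring

lemma coord_combo_lt {r : ℝ} {z : EuclideanSpace ℝ (Fin 2)} (hz : ‖z‖ < r) (α : ℝ) :
    z 0 * Real.cos α + z 1 * Real.sin α < r := by
  refine lt_of_le_of_lt ?_ hz
  have h1 : ‖z‖ ^ 2 = z 0 ^ 2 + z 1 ^ 2 := by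
    rw [EuclideanSpace.norm_sq_eq, Fin.sum_univ_two]
    simp
  refine abs_le_of_sq_le_sq' ?_ (norm_nonneg z) |>.2
  nlinarith [sq_nonneg (z 0 * Real.sin α - z 1 * Real.cos α), Real.sin_sq_add_cos_sq α]

/-- Inside the disc, the region beyond an arc grows with the end point of the arc. -/
lemma chordFun_nonneg_of_le_right {r α β β' : ℝ} {z : EuclideanSpace ℝ (Fin 2)} (hz : ‖z‖ < r)
    (h1 : α ≤ β) (h2 : β ≤ β') (h3 : β' ≤ α + 2 * Real.pi) (h : 0 < chordFun r α β z) :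
    0 ≤ chordFun r α β' z := by
  set A := r - (z 0 * Real.cos α + z 1 * Real.sin α) with hA
  set B := z 1 * Real.cos α - z 0 * Real.sin α with hB
  have hApos : 0 < A := sub_pos.2 (coord_combo_lt hz α)
  have hform : ∀ β, chordFun r α β z =
      B * Real.sin ((β - α) / 2) - A * Real.cos ((β - α) / 2) := by
    intro β
    have : (α + β) / 2 = α + (β - α) / 2 := by ring
    rw [chordFun, this, Real.cos_add, Real.sin_add, hA, hB]
    ring
  rw [hform] at h ⊢
  set γ := (β - α) / 2 with hγ
  set γ' := (β' - α) / 2 with hγ'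
  have hγ0 : 0 ≤ γ := by linarith
  have hγγ' : γ ≤ γ' := by linarith
  have hγ'π : γ' ≤ Real.pi := by linarith
  rcases hγγ'.eq_or_lt with heq | hlt
  · rw [← heq]
    exact h.le
  rcases hγ0.eq_or_lt with h0 | h0
  · rw [← h0] at h
    simp only [Real.sin_zero, Real.cos_zero] at h
    linarith
  have hs : 0 < Real.sin γ := Real.sin_pos_of_pos_of_lt_pi h0 (by linarith)
  have hs' : 0 ≤ Real.sin γ' := Real.sin_nonneg_of_nonneg_of_le_pi (by linarith) hγ'π
  have hd : 0 ≤ Real.sin (γ' - γ) :=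
    Real.sin_nonneg_of_nonneg_of_le_pi (by linarith) (by linarith)
  have key : (B * Real.sin γ' - A * Real.cos γ') * Real.sin γ =
      (B * Real.sin γ - A * Real.cos γ) * Real.sin γ' + A * Real.sin (γ' - γ) := by
    rw [Real.sin_sub]
    ring
  refine nonneg_of_mul_nonneg_left (b := Real.sin γ) ?_ hs
  rw [key]
  exact add_nonneg (mul_nonneg h.le hs') (mul_nonneg hApos.le hd)

/-- The line of all points whose inner product with the unit vector of polar angle `ψ` is `c`. -/
noncomputable def lineOfNormal (ψ c : ℝ) : AffineSubspace ℝ (EuclideanSpace ℝ (Fin 2)) :=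
  AffineSubspace.mk' (c • !₂[Real.cos ψ, Real.sin ψ])
    (Submodule.span ℝ {!₂[-Real.sin ψ, Real.cos ψ]})

lemma finrank_direction_lineOfNormal (ψ c : ℝ) :
    Module.finrank ℝ (lineOfNormal ψ c).direction = 1 := by
  rw [lineOfNormal, AffineSubspace.direction_mk']
  refine finrank_span_singleton fun h => ?_
  have h0 := congrArg (fun v : EuclideanSpace ℝ (Fin 2) => v 0) h
  have h1 := congrArg (fun v : EuclideanSpace ℝ (Fin 2) => v 1) h
  simp only [PiLp.zero_apply] at h0 h1
  have := Real.sin_sq_add_cos_sq ψ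
  simp at h0 h1
  simp [h0, h1] at this

lemma mem_lineOfNormal {ψ c : ℝ} {z : EuclideanSpace ℝ (Fin 2)} :
    z ∈ lineOfNormal ψ c ↔ z 0 * Real.cos ψ + z 1 * Real.sin ψ = c := by
  have hsc := Real.sin_sq_add_cos_sq ψ
  rw [lineOfNormal, AffineSubspace.mem_mk', Submodule.mem_span_singleton]
  constructor
  · rintro ⟨t, ht⟩
    have h0 := congrArg (fun v : EuclideanSpace ℝ (Fin 2) => v 0) ht
    have h1 := congrArg (fun v : EuclideanSpace ℝ (Fin 2) => v 1) ht
    simp at h0 h1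
    linear_combination -Real.cos ψ * h0 - Real.sin ψ * h1 + c * hsc
  · intro h
    refine ⟨z 1 * Real.cos ψ - z 0 * Real.sin ψ, ?_⟩
    ext i
    fin_cases i
    · simp
      linear_combination -Real.cos ψ * h + z 0 * hsc
    · simp
      linear_combination -Real.sin ψ * h + z 1 * hsc

/-- Piercing by exactly `k` lines is no stronger than piercing by at most `k`, since the plane has
infinitely many lines to add. -/
lemma piercedByLines_of_card_le {F : Set (Set (EuclideanSpace ℝ (Fin 2)))} {k : ℕ}
    (L : Finset (AffineSubspace ℝ (EuclideanSpace ℝ (Fin 2)))) (hcard : L.card ≤ k)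
    (hL : ∀ l ∈ L, Module.finrank ℝ l.direction = 1)
    (hF : ∀ A ∈ F, ∃ l ∈ L, (A ∩ (l : Set (EuclideanSpace ℝ (Fin 2)))).Nonempty) :
    PiercedByLines F k := by
  have hinj : Function.Injective (lineOfNormal 0) := by
    intro c d h
    have hmem : (!₂[c, 0] : EuclideanSpace ℝ (Fin 2)) ∈ lineOfNormal 0 c :=
      mem_lineOfNormal.2 (by simp)
    rw [h, mem_lineOfNormal] at hmem
    simpa using hmem
  have hinf : {l : AffineSubspace ℝ (EuclideanSpace ℝ (Fin 2)) |
      Module.finrank ℝ l.direction = 1}.Infinite :=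
    (infinite_range_of_injective hinj).mono
      (range_subset_iff.2 fun c => finrank_direction_lineOfNormal 0 c)
  obtain ⟨L', hLL', hL'card, hL'⟩ : ∃ L' : Finset (AffineSubspace ℝ (EuclideanSpace ℝ (Fin 2))),
      L ⊆ L' ∧ L'.card = k ∧ ∀ l ∈ L', Module.finrank ℝ l.direction = 1 := by
    classical
    obtain ⟨M, hM, hMcard⟩ :=
      (hinf.sdiff L.finite_toSet).exists_subset_card_eq (k - L.card)
    refine ⟨L ∪ M, Finset.subset_union_left, ?_, fun l hl => ?_⟩
    · rw [Finset.card_union_of_disjoint, hMcard]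
      · omega
      · exact Finset.disjoint_right.2 fun l hl => (hM hl).2
    · rcases Finset.mem_union.1 hl with hl | hl
      · exact hL l hl
      · exact (hM hl).1
  refine ⟨L', hL'card, hL', fun A hA => ?_⟩
  obtain ⟨l, hl, z, hzA, hzl⟩ := hF A hA
  exact ⟨z, hzA, mem_iUnion₂.2 ⟨l, hLL' hl, hzl⟩⟩

/-! ### The chords of a cyclic subdivision of the circle -/

section Cells

variable {m : ℕ}

/-- The polar angles of the division points when the circle is cut into arcs of lengths
`2π x 0, …, 2π x m`; the indices continue around the circle. -/
noncomputable def arcAngle (x : Fin (m + 1) → ℝ) (i : ℕ) : ℝ :=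
  2 * Real.pi * ∑ j ∈ Finset.range i, x (Fin.ofNat (m + 1) j)

lemma arcAngle_succ (x : Fin (m + 1) → ℝ) (i : ℕ) :
    arcAngle x (i + 1) = arcAngle x i + 2 * Real.pi * x (Fin.ofNat (m + 1) i) := by
  rw [arcAngle, Finset.sum_range_succ, mul_add, arcAngle]

lemma arcAngle_mono {x : Fin (m + 1) → ℝ} (hx : ∀ i, 0 ≤ x i) : Monotone (arcAngle x) :=
  monotone_nat_of_le_succ fun i => by
    rw [arcAngle_succ]
    have := hx (Fin.ofNat (m + 1) i)
    have := Real.pi_pos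
    exact le_add_of_nonneg_right (by positivity)

lemma arcAngle_add_card {x : Fin (m + 1) → ℝ} (hx : ∑ i, x i = 1) (i : ℕ) :
    arcAngle x (i + (m + 1)) = arcAngle x i + 2 * Real.pi := by
  have h1 : ∑ j ∈ Finset.range (m + 1), x (Fin.ofNat (m + 1) j) = 1 := by
    rw [Finset.sum_range, ← hx]
    refine Finset.sum_congr rfl fun j _ => ?_
    congr 1
    ext
    simp
  have h2 : ∀ j, Fin.ofNat (m + 1) (m + 1 + j) = Fin.ofNat (m + 1) j := by
    intro j
    ext
    simp
  rw [arcAngle, add_comm i, Finset.sum_range_add, h1, arcAngle]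
  simp_rw [h2]
  ring

/-- The affine function of the chord from the `i`-th division point to the one `k` places
further on. -/
noncomputable def diagFun (r : ℝ) (k : ℕ) (x : Fin (m + 1) → ℝ) (i : ℕ)
    (z : EuclideanSpace ℝ (Fin 2)) : ℝ :=
  chordFun r (arcAngle x i) (arcAngle x (i + k)) z

lemma diagFun_add {r : ℝ} {k : ℕ} (hk : m + 1 = 2 * k) {x : Fin (m + 1) → ℝ}
    (hx : ∑ i, x i = 1) (i : ℕ) (z : EuclideanSpace ℝ (Fin 2)) :
    diagFun r k x (i + k) z = -diagFun r k x i z := by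
  have : i + k + k = i + (m + 1) := by omega
  rw [diagFun, this, arcAngle_add_card hx, chordFun_swap, diagFun]

/-- If the `i`-th arc is degenerate, then no point of the disc lies on the positive side of the
`i`-th diagonal and on the negative side of the next one. -/
lemma diagFun_succ_nonneg {r : ℝ} {k : ℕ} (hk : m + 1 = 2 * k) {x : Fin (m + 1) → ℝ}
    (hx0 : ∀ i, 0 ≤ x i) (hx : ∑ i, x i = 1) {i : ℕ} (hi : x (Fin.ofNat (m + 1) i) = 0)
    {z : EuclideanSpace ℝ (Fin 2)} (hz : ‖z‖ < r) (h : 0 < diagFun r k x i z) :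
    0 ≤ diagFun r k x (i + 1) z := by
  have hmono := arcAngle_mono hx0
  have heq : arcAngle x (i + 1) = arcAngle x i := by rw [arcAngle_succ, hi, mul_zero, add_zero]
  rw [diagFun, heq]
  refine chordFun_nonneg_of_le_right hz (hmono (by omega)) (hmono (by omega)) ?_ h
  rw [← arcAngle_add_card hx]
  exact hmono (by omega)

/-- The points for which `i` is the first index such that the point is on the positive side of the
`i`-th diagonal and on the negative side of the next one. The negation for smaller indices is
expressed by strict inequalities, which makes this an open condition. -/
def InCell (r : ℝ) (k : ℕ) (x : Fin (m + 1) → ℝ) (i : ℕ) (z : EuclideanSpace ℝ (Fin 2)) : Prop :=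
  0 < diagFun r k x i z ∧ diagFun r k x (i + 1) z < 0 ∧
    ∀ j < i, diagFun r k x j z < 0 ∨ 0 < diagFun r k x (j + 1) z

lemma InCell.index_unique {r : ℝ} {k : ℕ} {x : Fin (m + 1) → ℝ} {i j : ℕ}
    {z : EuclideanSpace ℝ (Fin 2)} (hi : InCell r k x i z) (hj : InCell r k x j z) : i = j := by
  by_contra hne
  rcases lt_or_gt_of_ne hne with h | h
  · rcases hj.2.2 i h with h' | h'
    · exact h'.not_gt hi.1
    · exact h'.not_gt hi.2.1
  · rcases hi.2.2 j h with h' | h'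
    · exact h'.not_gt hj.1
    · exact h'.not_gt hj.2.1

lemma continuous_diagFun (r : ℝ) (k i : ℕ) :
    Continuous fun q : (Fin (m + 1) → ℝ) × EuclideanSpace ℝ (Fin 2) => diagFun r k q.1 i q.2 := by
  have ha : ∀ i, Continuous fun q : (Fin (m + 1) → ℝ) × EuclideanSpace ℝ (Fin 2) =>
      arcAngle q.1 i := by
    intro i
    simp only [arcAngle]
    fun_prop
  have h1 := ha i
  have h2 := ha (i + k)
  simp only [diagFun, chordFun]
  fun_prop

lemma isOpen_inCell (r : ℝ) (k i : ℕ) :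
    IsOpen {q : (Fin (m + 1) → ℝ) × EuclideanSpace ℝ (Fin 2) | InCell r k q.1 i q.2} := by
  have hc := continuous_diagFun (m := m) r k
  simp only [InCell, ofPred_and, ofPred_forall, ofPred_or]
  refine (isOpen_lt continuous_const (hc i)).inter
    ((isOpen_lt (hc (i + 1)) continuous_const).inter ?_)
  exact (finite_lt_nat i).isOpen_biInter fun j _ =>
    (isOpen_lt (hc j) continuous_const).union (isOpen_lt continuous_const (hc (j + 1)))

/-- A cyclically antisymmetric sign sequence descends somewhere within a period; the index given
is the first one where it does. -/
lemma exists_first_sign_descent {k : ℕ} (s : ℕ → Prop) (hs : ∀ i, s (i + k) ↔ ¬ s i) :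
    ∃ i < 2 * k, s i ∧ ¬ s (i + 1) ∧ ∀ j < i, ¬ s j ∨ s (j + 1) := by
  classical
  have hex : ∃ i, i < 2 * k ∧ s i ∧ ¬ s (i + 1) := by
    by_contra! hcon
    have hprop : ∀ a b, s a → a ≤ b → b ≤ 2 * k → s b := by
      intro a b ha hab
      induction b, hab using Nat.le_induction with
      | base => exact fun _ => ha
      | succ b _ ih => exact fun hb => hcon b (by omega) (ih (by omega))
    have h0 := hs 0
    have h1 := hs k
    rw [zero_add] at h0
    rw [← two_mul] at h1
    by_cases h : s 0
    · exact (h0.1 (hprop 0 k h (by omega) (by omega))) h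
    · have hk := h0.2 h
      exact (h1.1 (hprop k (2 * k) hk (by omega) le_rfl)) hk
  obtain ⟨h1, h2, h3⟩ := Nat.find_spec hex
  refine ⟨Nat.find hex, h1, h2, h3, fun j hj => ?_⟩
  have := Nat.find_min hex hj
  by_contra! hcon
  exact this ⟨hj.trans h1, hcon⟩

/-- A connected set that misses the first `k` diagonals is contained in a single cell. -/
lemma exists_forall_inCell {r : ℝ} {k : ℕ} (hk : m + 1 = 2 * k) {x : Fin (m + 1) → ℝ}
    (hx : ∑ i, x i = 1) {C : Set (EuclideanSpace ℝ (Fin 2))} (hC : IsPreconnected C)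
    (hne : C.Nonempty) (hmiss : ∀ i < k, ∀ z ∈ C, diagFun r k x i z ≠ 0) :
    ∃ i < 2 * k, ∀ z ∈ C, InCell r k x i z := by
  have hmiss' : ∀ i, ∀ z ∈ C, diagFun r k x i z ≠ 0 := by
    intro i
    induction i using Nat.strong_induction_on with
    | _ i ih =>
      intro z hz
      by_cases hi : i < k
      · exact hmiss i hi z hz
      · obtain ⟨j, rfl⟩ := Nat.exists_eq_add_of_le' (not_lt.1 hi)
        rw [diagFun_add hk hx]
        exact neg_ne_zero.2 (ih j (by omega) z hz)
  obtain ⟨w, hw⟩ := hne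
  have hsign : ∀ i, ∀ z ∈ C, (0 < diagFun r k x i z ↔ 0 < diagFun r k x i w) := by
    have hcont : ∀ i, ContinuousOn (diagFun r k x i) C := fun i =>
      ((continuous_diagFun r k i).comp (Continuous.prodMk_right x)).continuousOn
    have key : ∀ i, ∀ a ∈ C, ∀ b ∈ C, 0 < diagFun r k x i a → 0 < diagFun r k x i b := by
      intro i a ha b hb hpos
      by_contra hneg
      obtain ⟨c, hc, hc0⟩ := hC.intermediate_value hb ha (hcont i) ⟨not_lt.1 hneg, hpos.le⟩
      exact hmiss' i c hc hc0
    exact fun i z hz => ⟨key i z hz w hw, key i w hw z hz⟩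
  have hneg : ∀ i, ∀ z ∈ C, (¬ 0 < diagFun r k x i z ↔ diagFun r k x i z < 0) :=
    fun i z hz => not_lt.trans ⟨fun h => h.lt_of_ne (hmiss' i z hz), le_of_lt⟩
  obtain ⟨i, hi, h1, h2, h3⟩ := exists_first_sign_descent (k := k)
    (fun i => 0 < diagFun r k x i w) fun i => by
      rw [hneg i w hw, diagFun_add hk hx, neg_pos]
  refine ⟨i, hi, fun z hz => ⟨(hsign i z hz).2 h1, ?_, fun j hj => ?_⟩⟩
  · rw [← hneg (i + 1) z hz, hsign (i + 1) z hz]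
    exact h2
  · rw [← hneg j z hz, hsign j z hz, hsign (j + 1) z hz]
    exact h3 j hj

end Cells

/-! ### Piercing by lines -/

/-- A bounded family of convex sets that is not pierced by `k` lines has `2k` pairwise disjoint
members. -/
theorem exists_pairwise_disjoint_of_not_piercedByLines
    {F : Set (Set (EuclideanSpace ℝ (Fin 2)))} {k : ℕ} (hk : 1 ≤ k)
    (hF : ∀ A ∈ F, A.Nonempty ∧ IsCompact A ∧ Convex ℝ A)
    (hbdd : Bornology.IsBounded (⋃₀ F)) (hnot : ¬ PiercedByLines F k) :
    ∃ C : Fin (2 * k) → Set (EuclideanSpace ℝ (Fin 2)), (∀ i, C i ∈ F) ∧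
      Pairwise fun i j => Disjoint (C i) (C j) := by
  obtain ⟨r, hr⟩ := hbdd.subset_ball 0
  have hnorm : ∀ A ∈ F, ∀ z ∈ A, ‖z‖ < r := fun A hA z hz =>
    mem_ball_zero_iff.1 (hr ⟨A, hA, hz⟩)
  obtain ⟨m, hm⟩ : ∃ m, m + 1 = 2 * k := ⟨2 * k - 1, by omega⟩
  have hbc : Continuous (baryCoord : (Fin m → ℝ) → Fin (m + 1) → ℝ) :=
    continuous_pi continuous_baryCoord
  set U : Fin (m + 1) → Set (Fin m → ℝ) := fun i =>
    {y | ∃ A ∈ F, ∀ z ∈ A, InCell r k (baryCoord y) i z} with hU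
  have hopen : ∀ i, IsOpen (U i) := by
    intro i
    rw [isOpen_iff_mem_nhds]
    rintro y ⟨A, hA, hAy⟩
    have := (hF A hA).2.1.eventually_forall_of_forall_eventually (x₀ := y)
      (P := fun y z => InCell r k (baryCoord y) i z) fun z hz => by
        have hc : Continuous fun q : (Fin m → ℝ) × EuclideanSpace ℝ (Fin 2) =>
          (baryCoord q.1, q.2) := (hbc.comp continuous_fst).prodMk continuous_snd
        exact ((isOpen_inCell r k i).preimage hc).mem_nhds (hAy z hz)
    filter_upwards [this] with y' hy'
    exact ⟨A, hA, hy'⟩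
  have hcover : cornerSimplex m ⊆ ⋃ i, U i := by
    intro y _
    by_contra hy
    refine hnot ?_
    classical
    set x := baryCoord y with hx
    set ℓ : ℕ → AffineSubspace ℝ (EuclideanSpace ℝ (Fin 2)) := fun i =>
      lineOfNormal ((arcAngle x i + arcAngle x (i + k)) / 2)
        (r * Real.cos ((arcAngle x (i + k) - arcAngle x i) / 2)) with hℓ
    refine piercedByLines_of_card_le ((Finset.range k).image ℓ)
      (Finset.card_image_le.trans (Finset.card_range k).le) (fun l hl => ?_) fun A hA => ?_
    · obtain ⟨i, -, rfl⟩ := Finset.mem_image.1 hl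
      exact finrank_direction_lineOfNormal _ _
    · by_contra hmiss
      obtain ⟨i, hi, hcell⟩ := exists_forall_inCell (r := r) hm (sum_baryCoord y)
        (hF A hA).2.2.isPreconnected (hF A hA).1 fun i hi z hz h0 => hmiss
          ⟨ℓ i, Finset.mem_image_of_mem ℓ (Finset.mem_range.2 hi), z, hz,
            mem_lineOfNormal.2 (sub_eq_zero.1 h0)⟩
      exact hy (mem_iUnion.2 ⟨⟨i, by omega⟩, A, hA, hcell⟩)
  obtain ⟨y, -, hy⟩ := exists_mem_forall_mem_of_cover U hopen hcover fun y hy i hi h0 => by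
    obtain ⟨A, hA, hcell⟩ := hi
    obtain ⟨z, hz⟩ := (hF A hA).1
    obtain ⟨h1, h2, -⟩ := hcell z hz
    refine h2.not_ge (diagFun_succ_nonneg hm hy (sum_baryCoord y) ?_ (hnorm A hA z hz) h1)
    simpa using h0
  choose C hC hcell using hy
  refine ⟨fun i => C (Fin.cast hm.symm i), fun i => hC _, fun i j hij => ?_⟩
  refine Set.disjoint_left.2 fun z hzi hzj => hij ?_
  have := (hcell _ z hzi).index_unique (hcell _ z hzj)
  exact Fin.ext this

lemma HasPQProperty.exists_not_disjoint {X : Type*} {F : Set (Set X)} {n : ℕ}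
    (h : HasPQProperty F n 2) (S : Finset (Set X)) (hS : (S : Set (Set X)) ⊆ F)
    (hcard : n ≤ S.card) : ¬ (S : Set (Set X)).PairwiseDisjoint id := by
  intro hdisj
  obtain ⟨S', hS', hcard'⟩ := Finset.exists_subset_card_eq hcard
  obtain ⟨T, hT, hT2, x, hx⟩ := h S' ((Finset.coe_subset.2 hS').trans hS) hcard'
  obtain ⟨A, B, hAB, rfl⟩ := Finset.card_eq_two.1 hT2
  have hA : A ∈ S := hS' (hT (by simp))
  have hB : B ∈ S := hS' (hT (by simp))
  simp only [mem_iInter] at hx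
  exact Set.disjoint_left.1 (hdisj hA hB hAB) (hx A (by simp)) (hx B (by simp))

theorem hasPQProperty_two_iff_matchingNumber_le {X : Type*} (F : Set (Set X)) (p : ℕ) :
    HasPQProperty F (p + 1) 2 ↔ matchingNumber F ≤ p := by
  constructor
  · intro h
    refine iSup₂_le fun S hS => ?_
    by_contra hcon
    rw [not_le, Nat.cast_lt] at hcon
    exact h.exists_not_disjoint S hS.1 hcon hS.2
  · intro h S hS hcard
    classical
    have hnot : ¬ (S : Set (Set X)).PairwiseDisjoint id := by
      intro hdisj
      have h1 : (S.card : ℕ∞) ≤ matchingNumber F :=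
        le_iSup₂_of_le (f := fun (S : Finset (Set X)) _ => (S.card : ℕ∞)) S ⟨hS, hdisj⟩ le_rfl
      have h2 := h1.trans h
      rw [Nat.cast_le] at h2
      omega
    simp only [Set.PairwiseDisjoint, Set.Pairwise] at hnot
    push Not at hnot
    obtain ⟨A, hA, B, hB, hAB, hdis⟩ := hnot
    obtain ⟨x, hxA, hxB⟩ := Set.not_disjoint_iff.1 hdis
    refine ⟨{A, B}, ?_, Finset.card_pair hAB, x, ?_⟩
    · intro C hC
      rcases Finset.mem_insert.1 hC with rfl | hC
      · exact hA
      · rw [Finset.mem_singleton.1 hC]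
        exact hB
    · simp only [mem_iInter, Finset.mem_insert, Finset.mem_singleton]
      rintro C (rfl | rfl)
      exacts [hxA, hxB]

theorem piercedByLines_of_hasPQProperty {F : Set (Set (EuclideanSpace ℝ (Fin 2)))}
    (hfin : F.Finite) (hF : ∀ A ∈ F, A.Nonempty ∧ IsCompact A ∧ Convex ℝ A) {p : ℕ}
    (h : HasPQProperty F (p + 1) 2) : PiercedByLines F (p / 2 + 1) := by
  classical
  by_contra hnot
  obtain ⟨C, hC, hdisj⟩ := exists_pairwise_disjoint_of_not_piercedByLines (by omega) hF
    ((Bornology.isBounded_sUnion hfin).2 fun A hA => (hF A hA).2.1.isBounded) hnot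
  have hinj : Function.Injective C := by
    intro i j hij
    by_contra hne
    have : Disjoint (C i) (C j) := hdisj hne
    rw [hij, disjoint_self] at this
    exact (hF _ (hC j)).1.ne_empty this
  refine h.exists_not_disjoint (Finset.univ.image C) ?_ ?_ ?_
  · intro A hA
    obtain ⟨i, -, rfl⟩ := Finset.mem_image.1 (Finset.mem_coe.1 hA)
    exact hC i
  · rw [Finset.card_image_of_injective _ hinj, Finset.card_univ, Fintype.card_fin]
    omega
  · intro A hA B hB hAB
    obtain ⟨i, -, rfl⟩ := Finset.mem_image.1 (Finset.mem_coe.1 hA)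
    obtain ⟨j, -, rfl⟩ := Finset.mem_image.1 (Finset.mem_coe.1 hB)
    exact hdisj fun hij => hAB (congrArg C hij)

/-! ### The edges of a regular polygon -/

section Polygon

variable {n : ℕ} {c : EuclideanSpace ℝ (Fin 2)} {r θ : ℝ}

lemma regularPolygonVertex_self (hn : n ≠ 0) :
    regularPolygonVertex n c r θ n = regularPolygonVertex n c r θ 0 := by
  have h : θ + 2 * Real.pi * n / n = θ + 2 * Real.pi := by
    field_simp
  simp [regularPolygonVertex, h]

lemma finite_regularPolygonEdges : (regularPolygonEdges n c r θ).Finite := by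
  refine ((finite_lt_nat n).image fun j => segment ℝ (regularPolygonVertex n c r θ j)
    (regularPolygonVertex n c r θ (j + 1))).subset ?_
  rintro _ ⟨j, hj, rfl⟩
  exact ⟨j, hj, rfl⟩

lemma regularPolygonEdges_convex_body {A : Set (EuclideanSpace ℝ (Fin 2))}
    (hA : A ∈ regularPolygonEdges n c r θ) : A.Nonempty ∧ IsCompact A ∧ Convex ℝ A := by
  obtain ⟨j, -, rfl⟩ := hA
  refine ⟨⟨_, left_mem_segment ℝ _ _⟩, ?_, convex_segment _ _⟩
  rw [segment_eq_image]
  exact isCompact_Icc.image (by fun_prop)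

/-- Among more than half of the edges, two are consecutive and share a vertex. -/
lemma hasPQProperty_regularPolygonEdges (p : ℕ) (hp : 1 ≤ p) :
    HasPQProperty (regularPolygonEdges (2 * p + 1) c r θ) (p + 1) 2 := by
  classical
  intro S hS hcard
  set n := 2 * p + 1 with hn
  have : Fact (1 < n) := ⟨by omega⟩
  choose! idx hlt hidx using fun A (hA : A ∈ S) => hS hA
  have hinj : InjOn (fun A => (idx A : ZMod n)) S := by
    intro A hA B hB hAB
    have h1 : idx A = idx B := by
      have := (ZMod.natCast_eq_natCast_iff' _ _ _).1 hAB
      rwa [Nat.mod_eq_of_lt (hlt A hA), Nat.mod_eq_of_lt (hlt B hB)] at this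
    rw [hidx A hA, hidx B hB, h1]
  have hsucc : InjOn (fun A => (idx A : ZMod n) + 1) S := fun A hA B hB hAB =>
    hinj hA hB (add_right_cancel hAB)
  obtain ⟨q, hq⟩ : ((S.image fun A => (idx A : ZMod n)) ∩
      S.image fun A => (idx A : ZMod n) + 1).Nonempty := by
    rw [Finset.nonempty_iff_ne_empty, ne_eq, ← Finset.disjoint_iff_inter_eq_empty]
    intro hdisj
    have h1 := Finset.card_union_of_disjoint hdisj
    rw [Finset.card_image_of_injOn hinj, Finset.card_image_of_injOn hsucc, hcard] at h1
    have h2 := Finset.card_le_univ ((S.image fun A => (idx A : ZMod n)) ∪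
      S.image fun A => (idx A : ZMod n) + 1)
    rw [ZMod.card] at h2
    omega
  obtain ⟨hqA, hqB⟩ := Finset.mem_inter.1 hq
  obtain ⟨A, hA, rfl⟩ := Finset.mem_image.1 hqA
  obtain ⟨B, hB, hBA⟩ := Finset.mem_image.1 hqB
  have hne : A ≠ B := by
    rintro rfl
    simp at hBA
  have hvertex : regularPolygonVertex n c r θ (idx B + 1) =
      regularPolygonVertex n c r θ (idx A) := by
    have h1 : (idx B + 1) % n = idx A % n :=
      (ZMod.natCast_eq_natCast_iff' _ _ _).1 (by push_cast; exact hBA)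
    rw [Nat.mod_eq_of_lt (hlt A hA)] at h1
    rcases (Nat.succ_le_of_lt (hlt B hB)).eq_or_lt with h | h
    · rw [Nat.succ_eq_add_one] at h
      rw [h, Nat.mod_self] at h1
      rw [h, ← h1, regularPolygonVertex_self (by omega)]
    · rw [Nat.mod_eq_of_lt h] at h1
      rw [← h1]
  refine ⟨{A, B}, ?_, Finset.card_pair hne, regularPolygonVertex n c r θ (idx A), ?_⟩
  · exact Finset.insert_subset hA (Finset.singleton_subset_iff.2 hB)
  · simp only [mem_iInter, Finset.mem_insert, Finset.mem_singleton]
    rintro C (rfl | rfl)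
    · nth_rewrite 1 [hidx C hA]
      exact left_mem_segment ℝ _ _
    · nth_rewrite 1 [hidx C hB]
      rw [← hvertex]
      exact right_mem_segment ℝ _ _

/-- A line in the plane is contained in the zero set of a nontrivial linear equation. -/
lemma exists_linear_equation_of_finrank_direction
    {l : AffineSubspace ℝ (EuclideanSpace ℝ (Fin 2))} (hl : Module.finrank ℝ l.direction = 1) :
    ∃ a b κ : ℝ, (a ≠ 0 ∨ b ≠ 0) ∧ ∀ z ∈ l, a * z 0 + b * z 1 = κ := by
  obtain ⟨d, hd, hspan⟩ := finrank_eq_one_iff'.1 hl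
  have hd' : (d : EuclideanSpace ℝ (Fin 2)) ≠ 0 := fun h => hd (Subtype.ext h)
  obtain ⟨z₀, hz₀⟩ : (l : Set (EuclideanSpace ℝ (Fin 2))).Nonempty := by
    rw [AffineSubspace.nonempty_iff_ne_bot]
    rintro rfl
    rw [AffineSubspace.direction_bot, finrank_bot] at hl
    exact zero_ne_one hl
  refine ⟨-(d : EuclideanSpace ℝ (Fin 2)) 1, (d : EuclideanSpace ℝ (Fin 2)) 0,
    -(d : EuclideanSpace ℝ (Fin 2)) 1 * z₀ 0 + (d : EuclideanSpace ℝ (Fin 2)) 0 * z₀ 1, ?_, ?_⟩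
  · by_contra! h
    refine hd' ?_
    ext i
    fin_cases i
    · exact h.2
    · exact neg_eq_zero.1 h.1
  · intro z hz
    obtain ⟨t, ht⟩ := hspan ⟨z -ᵥ z₀, AffineSubspace.vsub_mem_direction hz hz₀⟩
    have ht' : t • (d : EuclideanSpace ℝ (Fin 2)) = z - z₀ := congrArg Subtype.val ht
    have h0 := congrArg (fun v : EuclideanSpace ℝ (Fin 2) => v 0) ht'
    have h1 := congrArg (fun v : EuclideanSpace ℝ (Fin 2) => v 1) ht'
    simp at h0 h1
    linear_combination (d : EuclideanSpace ℝ (Fin 2)) 1 * h0 -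
      (d : EuclideanSpace ℝ (Fin 2)) 0 * h1

/-- A line meets a circle in at most two points. -/
lemma exists_two_angles {a b : ℝ} (hab : a ≠ 0 ∨ b ≠ 0) (κ : ℝ) :
    ∃ σ : Bool → ℝ, ∀ t, a * Real.cos t + b * Real.sin t = κ →
      ∃ (e : Bool) (k : ℤ), t = σ e + 2 * Real.pi * k := by
  by_cases hex : ∃ t, a * Real.cos t + b * Real.sin t = κ
  swap
  · exact ⟨fun _ => 0, fun t ht => absurd ⟨t, ht⟩ hex⟩
  obtain ⟨τ, hτ⟩ := hex
  set w : ℂ := ⟨a, b⟩ with hw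
  have hw0 : ‖w‖ ≠ 0 := by
    rw [norm_ne_zero_iff]
    intro h
    have h1 := congrArg Complex.re h
    have h2 := congrArg Complex.im h
    simp [hw] at h1 h2
    tauto
  have ha : ‖w‖ * Real.cos w.arg = a := Complex.norm_mul_cos_arg w
  have hb : ‖w‖ * Real.sin w.arg = b := Complex.norm_mul_sin_arg w
  have hform : ∀ t, a * Real.cos t + b * Real.sin t = ‖w‖ * Real.cos (t - w.arg) := by
    intro t
    rw [Real.cos_sub]
    linear_combination -Real.cos t * ha - Real.sin t * hb
  refine ⟨fun e => if e then τ else 2 * w.arg - τ, fun t ht => ?_⟩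
  rw [← hτ, hform, hform, mul_right_inj' hw0, Real.cos_eq_cos_iff] at ht
  obtain ⟨k, hk | hk⟩ := ht
  · refine ⟨true, -k, ?_⟩
    simp only [if_true]
    push_cast
    linarith
  · refine ⟨false, k, ?_⟩
    simp only [Bool.false_eq_true, if_false]
    linarith

/-- If a line meets an edge, then it meets the circumcircle in the closed arc over that edge. -/
lemma exists_angle_of_mem_edge {a b κ : ℝ} {j : ℕ} {z : EuclideanSpace ℝ (Fin 2)}
    (hz : z ∈ segment ℝ (regularPolygonVertex n c r θ j) (regularPolygonVertex n c r θ (j + 1)))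
    (hκ : a * z 0 + b * z 1 = κ) :
    ∃ t, θ + 2 * Real.pi * j / n ≤ t ∧ t ≤ θ + 2 * Real.pi * (j + 1) / n ∧
      a * r * Real.cos t + b * r * Real.sin t = κ - a * c 0 - b * c 1 := by
  set h : ℝ → ℝ := fun t =>
    a * r * Real.cos t + b * r * Real.sin t - (κ - a * c 0 - b * c 1) with hh
  obtain ⟨s, s', hs, hs', hss, rfl⟩ := hz
  set t₀ := θ + 2 * Real.pi * j / n with ht₀
  set t₁ := θ + 2 * Real.pi * (j + 1) / n with ht₁
  have hle : t₀ ≤ t₁ := by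
    have := Real.pi_pos
    rw [ht₀, ht₁]
    gcongr
    linarith
  have hcomb : s * h t₀ + s' * h t₁ = 0 := by
    simp [regularPolygonVertex, ← ht₀, ← ht₁] at hκ
    simp only [hh]
    linear_combination hκ + (a * c 0 + b * c 1 - κ - a * c 0 - b * c 1) * hss
  have hzero : (0 : ℝ) ∈ uIcc (h t₀) (h t₁) := by
    rw [← hcomb]
    exact segment_eq_uIcc (h t₀) (h t₁) ▸ ⟨s, s', hs, hs', hss, by simp⟩
  obtain ⟨t, ht, ht0⟩ := intermediate_value_uIcc (f := h) (a := t₀) (b := t₁)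
    (by fun_prop) hzero
  rw [uIcc_of_le hle] at ht
  exact ⟨t, ht.1, ht.2, sub_eq_zero.1 ht0⟩

/-- A line meets at most four edges of a regular polygon, as each of its at most two points on the
circumcircle lies in at most two closed arcs. -/
lemma exists_edge_indices_of_line [NeZero n] {l : AffineSubspace ℝ (EuclideanSpace ℝ (Fin 2))}
    (hr : 0 < r) (hl : Module.finrank ℝ l.direction = 1) :
    ∃ N : Finset (ZMod n), N.card ≤ 4 ∧ ∀ j : ℕ,
      (segment ℝ (regularPolygonVertex n c r θ j) (regularPolygonVertex n c r θ (j + 1)) ∩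
        (l : Set (EuclideanSpace ℝ (Fin 2)))).Nonempty → (j : ZMod n) ∈ N := by
  classical
  obtain ⟨a, b, κ, hab, heq⟩ := exists_linear_equation_of_finrank_direction hl
  obtain ⟨σ, hσ⟩ := exists_two_angles (a := a * r) (b := b * r)
    (hab.imp (fun h => mul_ne_zero h hr.ne') fun h => mul_ne_zero h hr.ne')
    (κ - a * c 0 - b * c 1)
  have hn : (0 : ℝ) < n := Nat.cast_pos.2 (NeZero.pos n)
  have hπ := Real.pi_pos
  -- The position of each intersection point on the circle, in units of arcs.
  set s : Bool → ℝ := fun e => (σ e - θ) * n / (2 * Real.pi) with hs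
  refine ⟨Finset.univ.image fun e : Bool × Bool =>
    ((if e.2 then ⌊s e.1⌋ else ⌈s e.1⌉ - 1 : ℤ) : ZMod n), ?_, ?_⟩
  · exact Finset.card_image_le.trans (by simp)
  · rintro j ⟨z, hz, hzl⟩
    obtain ⟨t, ht1, ht2, ht⟩ := exists_angle_of_mem_edge hz (heq z hzl)
    obtain ⟨e, k, rfl⟩ := hσ t ht
    set q : ℤ := j - n * k with hq
    have hσe : σ e = θ + 2 * Real.pi * s e / n := by
      simp only [hs]
      field_simp
      ring
    have h1 : (q : ℝ) ≤ s e := by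
      have : 2 * Real.pi / n * j ≤ 2 * Real.pi / n * (s e + n * k) := by
        rw [hσe] at ht1
        have h : 2 * Real.pi / n * (s e + n * k) = 2 * Real.pi * s e / n + 2 * Real.pi * k := by
          field_simp
        rw [h, div_mul_eq_mul_div]
        linarith
      have := le_of_mul_le_mul_left this (by positivity)
      rw [hq]
      push_cast
      linarith
    have h2 : s e ≤ q + 1 := by
      have : 2 * Real.pi / n * (s e + n * k) ≤ 2 * Real.pi / n * (j + 1) := by
        rw [hσe] at ht2
        have h : 2 * Real.pi / n * (s e + n * k) = 2 * Real.pi * s e / n + 2 * Real.pi * k := by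
          field_simp
        rw [h, div_mul_eq_mul_div]
        linarith
      have := le_of_mul_le_mul_left this (by positivity)
      rw [hq]
      push_cast
      linarith
    have hqj : (q : ZMod n) = j := by
      rw [hq]
      push_cast
      simp
    rw [← hqj, Finset.mem_image]
    rcases h2.lt_or_eq with h | h
    · refine ⟨(e, true), Finset.mem_univ _, ?_⟩
      rw [if_pos rfl, Int.floor_eq_iff.2 ⟨h1, h⟩]
    · refine ⟨(e, false), Finset.mem_univ _, ?_⟩
      have : s e = ((q + 1 : ℤ) : ℝ) := by
        push_cast
        exact h
      simp [this]

lemma card_le_of_piercedByLines_regularPolygonEdges [NeZero n] (hr : 0 < r) {k : ℕ}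
    (h : PiercedByLines (regularPolygonEdges n c r θ) k) : n ≤ 4 * k := by
  classical
  obtain ⟨L, rfl, hL, hF⟩ := h
  choose! N hN hNmem using fun l hl =>
    exists_edge_indices_of_line (n := n) (c := c) (θ := θ) hr (hL l hl)
  have hcover : (Finset.univ : Finset (ZMod n)) ⊆ L.biUnion N := by
    intro q _
    obtain ⟨z, hz, hzL⟩ := hF _ ⟨q.val, q.val_lt, rfl⟩
    obtain ⟨l, hl, hzl⟩ := mem_iUnion₂.1 hzL
    have := hNmem l hl q.val ⟨z, hz, hzl⟩
    rw [ZMod.natCast_zmod_val] at this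
    exact Finset.mem_biUnion.2 ⟨l, hl, this⟩
  have h1 := (Finset.card_le_card hcover).trans (Finset.card_biUnion_le_card_mul L N 4 hN)
  rw [Finset.card_univ, ZMod.card] at h1
  omega

end Polygon

theorem mainTheorem1 (p : ℕ) (hp : 1 ≤ p) :
    -- the `(p + 1, 2)` property says that the matching number is at most `p`
    (∀ F : Set (Set (EuclideanSpace ℝ (Fin 2))),
      HasPQProperty F (p + 1) 2 ↔ matchingNumber F ≤ p) ∧
    -- the upper bound on the number of lines
    (∀ F : Set (Set (EuclideanSpace ℝ (Fin 2))), F.Finite →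
      (∀ A ∈ F, A.Nonempty ∧ IsCompact A ∧ Convex ℝ A) →
      HasPQProperty F (p + 1) 2 → PiercedByLines F (p / 2 + 1)) ∧
    -- tightness: the edges of any regular `(2 * p + 1)`-gon
    (∀ (c : EuclideanSpace ℝ (Fin 2)) (r θ : ℝ), 0 < r →
      (regularPolygonEdges (2 * p + 1) c r θ).Finite ∧
      (∀ A ∈ regularPolygonEdges (2 * p + 1) c r θ, A.Nonempty ∧ IsCompact A ∧ Convex ℝ A) ∧
      HasPQProperty (regularPolygonEdges (2 * p + 1) c r θ) (p + 1) 2 ∧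
      IsLeast {k : ℕ | PiercedByLines (regularPolygonEdges (2 * p + 1) c r θ) k} (p / 2 + 1)) := by
  refine ⟨fun F => hasPQProperty_two_iff_matchingNumber_le F p,
    fun F hfin hF h => piercedByLines_of_hasPQProperty hfin hF h, fun c r θ hr => ?_⟩
  refine ⟨finite_regularPolygonEdges, fun A => regularPolygonEdges_convex_body,
    hasPQProperty_regularPolygonEdges p hp, ?_, fun k hk => ?_⟩
  · exact piercedByLines_of_hasPQProperty finite_regularPolygonEdges
      (fun A => regularPolygonEdges_convex_body) (hasPQProperty_regularPolygonEdges p hp)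
  · have := card_le_of_piercedByLines_regularPolygonEdges hr hk
    omega
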